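/- Let $K$ be a field of characteristic zero, let $\mathfrak g\neq\{0\}$ be a finite-dimensional semisimple Lie algebra over $K$, and let $k$ be a positive integer. Then there exists a finite-dimensional irreducible representation $\rho:\mathfrak g\to\mathfrak{gl}(V)$ over $K$ whose jet-order (exists and) is greater than $k$. Here, for a subspace $W\subset V$, write $\rho(\mathfrak g)(W)=\{\rho(x)(v)\mid x\in\mathfrak g,\ v\in W\}$ (the set itself, not its linear span). A jet-filtration on $\rho$ of length $n\ge 0$ is a chain of subspaces $$\{0\}\subsetneq V_1\subsetneq V_2\subsetneq\cdots\subsetneq V_n\subsetneq V$$ such that, with $V_{n+1}=V$, $$V_i\subsetneq\rho(\mathfrak g)(V_i)\subset V_{i+1}\qquad(1\le i\le n).$$ A jet-filtration is maximally refined if no jet-filtration on $\rho$ is obtained from it by inserting further subspaces. The jet-order of $\rho$ is the maximum of the lengths of all maximally refined jet-filtrations on $\rho$. -/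

import Mathlib

universe u v

/-- For a representation `ρ` of the Lie algebra `L` on `M` (written `⁅x, v⁆ = ρ(x)(v)`), the set
`ρ(L)(W) = {ρ(x)(v) | x ∈ L, v ∈ W}`.  This is the set itself, not its linear span. -/
def lieActionSet (K L : Type*) {M : Type*} [Field K] [LieRing L] [AddCommGroup M] [Module K M]
    [LieRingModule L M] (W : Submodule K M) : Set M :=
  {m | ∃ x : L, ∃ v ∈ W, ⁅x, v⁆ = m}

/-- A jet-filtration of length `k`: subspaces `0 = F 0 ⊊ F 1 ⊊ … ⊊ F k ⊊ F (k + 1) = M` such that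
`F i ⊊ ρ(L)(F i) ⊆ F (i + 1)` for `1 ≤ i ≤ k`. -/
structure IsJetFiltration (K L : Type*) {M : Type*} [Field K] [LieRing L] [AddCommGroup M]
    [Module K M] [LieRingModule L M] {k : ℕ} (F : Fin (k + 2) → Submodule K M) : Prop where
  zero_eq_bot : F 0 = ⊥
  last_eq_top : F (Fin.last (k + 1)) = ⊤
  strictMono : StrictMono F
  ssubset_action : ∀ i : Fin (k + 1), i ≠ 0 →
    (F i.castSucc : Set M) ⊂ lieActionSet K L (F i.castSucc)
  action_subset : ∀ i : Fin (k + 1), i ≠ 0 →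
    lieActionSet K L (F i.castSucc) ⊆ (F i.succ : Set M)

/-- A jet-filtration is maximally refined if no further subspaces can be inserted: every
jet-filtration that contains all of its terms has no other terms. -/
def IsMaximallyRefinedJetFiltration (K L : Type*) {M : Type*} [Field K] [LieRing L]
    [AddCommGroup M] [Module K M] [LieRingModule L M] {k : ℕ}
    (F : Fin (k + 2) → Submodule K M) : Prop :=
  IsJetFiltration K L F ∧
    ∀ (l : ℕ) (G : Fin (l + 2) → Submodule K M), IsJetFiltration K L G →
      Set.range F ⊆ Set.range G → Set.range G ⊆ Set.range F

/-- `n` is the jet-order of the representation `M` of `L`: the maximum of the lengths of all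
maximally refined jet-filtrations on `M`. -/
def IsJetOrder (K L M : Type*) [Field K] [LieRing L] [AddCommGroup M] [Module K M]
    [LieRingModule L M] (n : ℕ) : Prop :=
  IsGreatest {k : ℕ | ∃ F : Fin (k + 2) → Submodule K M,
    IsMaximallyRefinedJetFiltration K L F} n

/-! Choose `x` with `ad x` not nilpotent and a nonzero eigenvalue `a` of `ad x` in an algebraic
closure `F`. For every natural `m`, some irreducible `V` has `m * a` as an eigenvalue of `x`. The
conjugates of `m * a` are `m` times those of `a`, so their number does not depend on `m`. Hence `V`
contains a nonzero `x`-invariant `W` of dimension bounded independently of `m`, on which `x` has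
only such conjugates as eigenvalues.

Let `W_i` be the `i`-th term of `lieFiltration K L W`. Its eigenvalues under `x` are conjugates of
`m * a` shifted by sums from the fixed finite set `adEigenvalues`. For suitable `m` none of them
vanishes when `i ≤ k` (`eq_zero_of_lie_eq_zero_of_mem_lieFiltration`). Then `x` is bijective on
`W_i`, so every element of `W_i` is a single bracket with `x`; no linear span is needed.

Moreover `dim W_k ≤ B` with `B` independent of `m` (`finrank_lieFiltration_le`), while `dim V > B`:
since `x` acts with trace zero, `dim V ≤ B` would confine `m * a` to a finite set depending on `B`
only (`exists_nsmul_eigenvalue_add_eq_zero`). So `W_0, …, W_k` are proper and nonzero,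
irreducibility makes the inclusions strict, and the chain has length `k + 1`. -/

open Module LieModule TensorProduct

/-! ### The filtration generated by a subspace. -/

section LieFiltration

variable (K L : Type*) {M : Type*} [Field K] [LieRing L] [LieAlgebra K L]
  [AddCommGroup M] [Module K M] [LieRingModule L M] [LieModule K L M]

/-- The increasing filtration generated by a subspace `W`: the `n`-th term is spanned by the
iterated brackets of at most `n` elements of `L` with an element of `W`. -/
def lieFiltration (W : Submodule K M) : ℕ → Submodule K M
  | 0 => W
  | n + 1 => lieFiltration W n ⊔
      Submodule.map₂ (toEnd K L M : L →ₗ[K] M →ₗ[K] M) ⊤ (lieFiltration W n)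

variable (W : Submodule K M)

@[simp] lemma lieFiltration_zero : lieFiltration K L W 0 = W := rfl

lemma lieFiltration_succ (n : ℕ) : lieFiltration K L W (n + 1) = lieFiltration K L W n ⊔
    Submodule.map₂ (toEnd K L M : L →ₗ[K] M →ₗ[K] M) ⊤ (lieFiltration K L W n) := rfl

lemma lieFiltration_mono : Monotone (lieFiltration K L W) :=
  monotone_nat_of_le_succ fun _ => le_sup_left

variable {K L W} in
lemma lie_mem_lieFiltration_succ {n : ℕ} {m : M} (y : L) (hm : m ∈ lieFiltration K L W n) :
    ⁅y, m⁆ ∈ lieFiltration K L W (n + 1) :=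
  Submodule.mem_sup_right
    (Submodule.apply_mem_map₂ (toEnd K L M : L →ₗ[K] M →ₗ[K] M) (Submodule.mem_top (x := y)) hm)

variable {K L W} in
lemma lieFiltration_succ_le {n : ℕ} {N : Submodule K M} (h : lieFiltration K L W n ≤ N)
    (h' : ∀ (y : L), ∀ m ∈ lieFiltration K L W n, ⁅y, m⁆ ∈ N) :
    lieFiltration K L W (n + 1) ≤ N :=
  sup_le h (Submodule.map₂_le.2 fun y _ m hm => h' y m hm)

-- By Leibniz, `x` moves past a bracket with `y` at the cost of a bracket with `⁅x, y⁆`, again an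
-- element of `L`.
variable {K L W} in
lemma lie_mem_lieFiltration_of_invariant {x : L} (hW : ∀ m ∈ W, ⁅x, m⁆ ∈ W) (n : ℕ) :
    ∀ m ∈ lieFiltration K L W n, ⁅x, m⁆ ∈ lieFiltration K L W n := by
  induction n with
  | zero => exact hW
  | succ n ih =>
    suffices lieFiltration K L W (n + 1) ≤ (lieFiltration K L W (n + 1)).comap (toEnd K L M x) from
      this
    refine lieFiltration_succ_le (fun m hm => lie_mem_lieFiltration_succ x hm) fun y m hm => ?_
    rw [Submodule.mem_comap, toEnd_apply_apply, leibniz_lie]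
    exact add_mem (lie_mem_lieFiltration_succ _ hm) (lie_mem_lieFiltration_succ _ (ih m hm))

lemma Submodule.finrank_map₂_le_mul {N P : Type*} [AddCommGroup N] [Module K N] [AddCommGroup P]
    [Module K P] [FiniteDimensional K M] [FiniteDimensional K N]
    (f : M →ₗ[K] N →ₗ[K] P) (p : Submodule K M) (q : Submodule K N) :
    finrank K (Submodule.map₂ f p q) ≤ finrank K p * finrank K q := by
  have : Submodule.map₂ f p q =
      LinearMap.range (TensorProduct.lift (f.compl₁₂ p.subtype q.subtype)) := by
    apply le_antisymm
    · refine Submodule.map₂_le.2 fun m hm n hn => ⟨⟨m, hm⟩ ⊗ₜ ⟨n, hn⟩, by simp⟩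
    · rintro _ ⟨t, rfl⟩
      induction t with
      | zero => simp
      | add a b ha hb => rw [map_add]; exact add_mem ha hb
      | tmul a b => exact Submodule.apply_mem_map₂ f a.2 b.2
  rw [this, ← finrank_tensorProduct]
  exact LinearMap.finrank_range_le _

lemma finrank_lieFiltration_le [FiniteDimensional K L] [FiniteDimensional K M] (n : ℕ) :
    finrank K (lieFiltration K L W n) ≤ (1 + finrank K L) ^ n * finrank K W := by
  induction n with
  | zero => rw [pow_zero, one_mul]; rfl
  | succ n ih =>
    rw [lieFiltration_succ]
    have h1 := Submodule.finrank_add_le_finrank_add_finrank (lieFiltration K L W n)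
      (Submodule.map₂ (toEnd K L M : L →ₗ[K] M →ₗ[K] M) ⊤ (lieFiltration K L W n))
    have h2 := Submodule.finrank_map₂_le_mul K (toEnd K L M : L →ₗ[K] M →ₗ[K] M) ⊤
      (lieFiltration K L W n)
    rw [finrank_top] at h2
    calc _ ≤ _ := h1
      _ ≤ finrank K (lieFiltration K L W n) + finrank K L * finrank K (lieFiltration K L W n) := by
        gcongr
      _ = (1 + finrank K L) * finrank K (lieFiltration K L W n) := by ring
      _ ≤ (1 + finrank K L) * ((1 + finrank K L) ^ n * finrank K W) := by gcongr
      _ = _ := by ring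

variable {K L W} in
lemma lie_mem_of_lieFiltration_succ_eq {n : ℕ}
    (h : lieFiltration K L W (n + 1) = lieFiltration K L W n) (y : L) {m : M}
    (hm : m ∈ lieFiltration K L W n) : ⁅y, m⁆ ∈ lieFiltration K L W n :=
  h ▸ lie_mem_lieFiltration_succ y hm

/-- Each strict step raises the dimension. The stable term is a Lie submodule, and the bound on `n`
controls how many brackets generate it. -/
lemma exists_lieFiltration_succ_eq [FiniteDimensional K M] :
    ∃ n ≤ finrank K M, lieFiltration K L W (n + 1) = lieFiltration K L W n := by
  by_contra! h
  have key : ∀ n ≤ finrank K M + 1, n ≤ finrank K (lieFiltration K L W n) := by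
    intro n
    induction n with
    | zero => simp
    | succ n ih =>
      intro hn
      have hlt : lieFiltration K L W n < lieFiltration K L W (n + 1) :=
        lt_of_le_of_ne (lieFiltration_mono K L W n.le_succ) (h n (by omega)).symm
      have := Submodule.finrank_lt_finrank_of_lt hlt
      have := ih (by omega)
      omega
  have := key _ le_rfl
  have := Submodule.finrank_le (lieFiltration K L W (finrank K M + 1))
  omega

end LieFiltration

/-! ### Existence of the jet-order. -/

section JetOrder

variable {K L M : Type*} [Field K] [LieRing L] [AddCommGroup M] [Module K M]
  [LieRingModule L M]

lemma IsJetFiltration.le_finrank [FiniteDimensional K M] {k : ℕ} {F : Fin (k + 2) → Submodule K M}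
    (hF : IsJetFiltration K L F) : k + 1 ≤ finrank K M := by
  have key : ∀ i : Fin (k + 2), (i : ℕ) ≤ finrank K (F i) := by
    intro i
    induction i using Fin.induction with
    | zero => simp
    | succ i ih =>
      have := Submodule.finrank_lt_finrank_of_lt (hF.strictMono i.castSucc_lt_succ)
      simp only [Fin.val_succ, Fin.val_castSucc] at *
      omega
  have := key (Fin.last (k + 1))
  have := Submodule.finrank_le (F (Fin.last (k + 1)))
  simp at *
  omega

/-- The jet-order exists and is at least the length of any given jet-filtration. -/
lemma IsJetFiltration.exists_isJetOrder [FiniteDimensional K M] {k : ℕ}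
    {F : Fin (k + 2) → Submodule K M} (hF : IsJetFiltration K L F) :
    ∃ n, IsJetOrder K L M n ∧ k ≤ n := by
  classical
  let P : ℕ → Prop := fun k => ∃ F : Fin (k + 2) → Submodule K M, IsJetFiltration K L F
  have hP : P k := ⟨F, hF⟩
  have hb : ∀ l, P l → l ≤ finrank K M := fun l ⟨G, hG⟩ => by have := hG.le_finrank; omega
  let n := Nat.findGreatest P (finrank K M)
  obtain ⟨G, hG⟩ : P n := Nat.findGreatest_spec (hb k hP) hP
  have hmax : ∀ l, P l → l ≤ n := fun l hl => Nat.le_findGreatest (hb l hl) hl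
  -- A jet-filtration of greatest length is maximally refined: a refinement has no more terms, hence
  -- the same ones.
  refine ⟨n, ⟨⟨G, hG, fun l H hH hsub => ?_⟩, fun l ⟨H, hH, _⟩ => hmax l ⟨H, hH⟩⟩, hmax k hP⟩
  have hfin : (Set.range H).Finite := Set.finite_range H
  refine (Set.eq_of_subset_of_ncard_le hsub ?_ hfin).ge
  rw [← Nat.card_coe_set_eq, ← Nat.card_coe_set_eq,
    Nat.card_range_of_injective hH.strictMono.injective,
    Nat.card_range_of_injective hG.strictMono.injective]
  simpa using hmax l ⟨H, hH⟩

end JetOrder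

/-- A chain of subspaces starting from a subspace `W`, in an irreducible module. -/
lemma isJetFiltration_of_lieFiltration {K L M : Type*} [Field K] [LieRing L] [LieAlgebra K L]
    [AddCommGroup M] [Module K M] [LieRingModule L M] [LieModule K L M]
    [IsIrreducible K L M] {W : Submodule K M} (hW : W ≠ ⊥) {n : ℕ}
    (htop : lieFiltration K L W n ≠ ⊤)
    (hact : ∀ i ≤ n, (lieFiltration K L W i : Set M) ⊆ lieActionSet K L (lieFiltration K L W i)) :
    ∃ F : Fin (n + 1 + 2) → Submodule K M, IsJetFiltration K L F := by
  have hbot (i : ℕ) : lieFiltration K L W i ≠ ⊥ := fun h =>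
    hW (le_bot_iff.1 (h ▸ lieFiltration_mono K L W (Nat.zero_le i)))
  have htop' {i : ℕ} (hi : i ≤ n) : lieFiltration K L W i ≠ ⊤ := fun h =>
    htop (top_le_iff.1 (h ▸ lieFiltration_mono K L W hi))
  -- A stable term would be a submodule, against irreducibility; this gives both kinds of strictness
  -- below.
  have hnot {i : ℕ} (hi : i ≤ n) :
      ¬ ∀ (y : L), ∀ m ∈ lieFiltration K L W i, ⁅y, m⁆ ∈ lieFiltration K L W i := by
    intro h
    let N : LieSubmodule K L M := { lieFiltration K L W i with lie_mem := fun {y m} hm => h y m hm }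
    have hN : (N : Submodule K M) = lieFiltration K L W i := rfl
    rcases eq_bot_or_eq_top N with h' | h'
    · exact hbot i (by rw [← hN, h']; rfl)
    · exact htop' hi (by rw [← hN, h']; rfl)
  have hlt {i : ℕ} (hi : i ≤ n) : lieFiltration K L W i < lieFiltration K L W (i + 1) :=
    lt_of_le_of_ne (lieFiltration_mono K L W i.le_succ) fun h =>
      hnot hi fun y m hm => lie_mem_of_lieFiltration_succ_eq h.symm y hm
  let f : ℕ → Submodule K M := fun i =>
    if i = 0 then ⊥ else if i ≤ n + 1 then lieFiltration K L W (i - 1) else ⊤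
  have f0 : f 0 = ⊥ := rfl
  have f1 {i : ℕ} (hi : i ≤ n) : f (i + 1) = lieFiltration K L W i := by simp [f, hi]
  have f2 : f (n + 2) = ⊤ := by simp [f]
  refine ⟨fun i => f i, ⟨f0, by simpa using f2, Fin.strictMono_iff_lt_succ.2 ?_, ?_, ?_⟩⟩
  · rintro ⟨_ | i, hi⟩
    · simpa [f0, f1] using bot_lt_iff_ne_bot.2 hW
    · simp only [Fin.castSucc_mk, Fin.succ_mk]
      rw [f1 (by omega)]
      rcases Nat.lt_or_ge i n with h | h
      · rw [f1 (by omega)]; exact hlt (by omega)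
      · obtain rfl : i = n := by omega
        rw [f2]; exact lt_top_iff_ne_top.2 htop
  · rintro ⟨_ | i, hi⟩ h0
    · exact absurd rfl h0
    · simp only [Fin.castSucc_mk]
      rw [f1 (by omega)]
      refine ⟨hact i (by omega), fun h => hnot (i := i) (by omega) fun y m hm => h ⟨y, m, hm, rfl⟩⟩
  · rintro ⟨_ | i, hi⟩ h0
    · exact absurd rfl h0
    · simp only [Fin.castSucc_mk, Fin.succ_mk]
      rw [f1 (by omega)]
      rintro _ ⟨y, m, hm, rfl⟩
      rcases Nat.lt_or_ge i n with h | h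
      · rw [f1 (by omega)]; exact lie_mem_lieFiltration_succ y hm
      · obtain rfl : i = n := by omega
        rw [f2]; trivial

/-! ### Iterated sumsets. -/

section Sumset

variable {A : Type*} [AddCommMonoid A]

/-- The set of sums of `n` elements of `R`. -/
def iteratedSumset (R : Set A) : ℕ → Set A
  | 0 => {0}
  | n + 1 => Set.image2 (· + ·) R (iteratedSumset R n)

variable {R : Set A}

lemma iteratedSumset_finite (hR : R.Finite) (n : ℕ) : (iteratedSumset R n).Finite := by
  induction n with
  | zero => exact Set.finite_singleton 0
  | succ n ih => exact hR.image2 _ ih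

lemma add_mem_iteratedSumset {m n : ℕ} {a b : A} (ha : a ∈ iteratedSumset R m)
    (hb : b ∈ iteratedSumset R n) : a + b ∈ iteratedSumset R (m + n) := by
  induction m generalizing a with
  | zero =>
    obtain rfl : a = 0 := ha
    simpa using hb
  | succ m ih =>
    obtain ⟨r, hr, s, hs, rfl⟩ := ha
    rw [Nat.succ_add_eq_add_succ, Nat.add_succ]
    exact ⟨r, hr, s + b, ih hs, (add_assoc r s b).symm⟩

/-- Sums can be padded with zeros; this is why `adEigenvalues` contains `0`. -/
lemma iteratedSumset_mono (h0 : (0 : A) ∈ R) : Monotone (iteratedSumset R) :=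
  monotone_nat_of_le_succ fun _ a ha => ⟨0, h0, a, ha, zero_add a⟩

lemma Multiset.sum_eq_nsmul_add_of_mem_iteratedSumset {n : ℕ} {l : A} (s : Multiset A)
    (h : ∀ a ∈ s, ∃ r ∈ iteratedSumset R n, a = r + l) :
    ∃ t ∈ iteratedSumset R (s.card * n), s.sum = s.card • l + t := by
  induction s using Multiset.induction with
  | empty => exact ⟨0, by simp [iteratedSumset], by simp⟩
  | cons a s ih =>
    obtain ⟨t, ht, hs⟩ := ih fun b hb => h b (Multiset.mem_cons_of_mem hb)
    obtain ⟨r, hr, rfl⟩ := h a (Multiset.mem_cons_self a s)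
    refine ⟨r + t, ?_, ?_⟩
    · rw [Multiset.card_cons, add_mul, one_mul, add_comm]
      exact add_mem_iteratedSumset hr ht
    · rw [Multiset.sum_cons, hs, Multiset.card_cons, succ_nsmul]
      abel

end Sumset

/-! ### Sums of generalized eigenspaces. -/

section EigenSum

variable {F M : Type*} [Field F] [AddCommGroup M] [Module F M]

/-- The sum of the generalized eigenspaces of `f` for the scalars in `T`. -/
def genEigenSum (f : End F M) (T : Set F) : Submodule F M :=
  ⨆ μ ∈ T, f.maxGenEigenspace μ

lemma maxGenEigenspace_le_genEigenSum (f : End F M) {T : Set F} {μ : F} (hμ : μ ∈ T) :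
    f.maxGenEigenspace μ ≤ genEigenSum f T :=
  le_biSup (fun μ => f.maxGenEigenspace μ) hμ

lemma genEigenSum_mono (f : End F M) {S T : Set F} (h : S ⊆ T) :
    genEigenSum f S ≤ genEigenSum f T :=
  biSup_mono h

lemma mem_of_eigenvector_mem_genEigenSum {f : End F M} {T : Set F} {μ : F} {v : M}
    (hv : v ∈ genEigenSum f T) (h0 : v ≠ 0) (h : f v = μ • v) : μ ∈ T := by
  by_contra hμ
  have hd := f.independent_maxGenEigenspace.disjoint_biSup hμ
  refine h0 (Submodule.disjoint_def.1 hd v ?_ hv)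
  rw [End.mem_maxGenEigenspace]
  exact ⟨1, by simp [h]⟩

/-- The kernel of `q(f)` is `f`-invariant, so it splits along the generalized eigenspaces of `f`;
where `μ` is not a root, coprimality of `q` and `(X - μ) ^ k` kills the piece. -/
lemma mem_genEigenSum_of_aeval_eq_zero [IsAlgClosed F] [FiniteDimensional F M] {f : End F M}
    {q : Polynomial F} {m : M} (hm : Polynomial.aeval f q m = 0) :
    m ∈ genEigenSum f {μ | q.IsRoot μ} := by
  let N := LinearMap.ker (Polynomial.aeval f q)
  have hN : ∀ x ∈ N, f x ∈ N := fun x hx => by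
    have : Polynomial.aeval f q (f x) = f (Polynomial.aeval f q x) := by
      have := congrArg (Polynomial.aeval f) (mul_comm q Polynomial.X)
      rw [map_mul, map_mul, Polynomial.aeval_X] at this
      exact LinearMap.congr_fun this x
    rw [LinearMap.mem_ker, this, LinearMap.mem_ker.1 hx, map_zero]
  have key : N ⊓ ⨆ μ, f.maxGenEigenspace μ = ⨆ μ, N ⊓ f.maxGenEigenspace μ :=
    Submodule.inf_iSup_genEigenspace hN ⊤
  rw [f.iSup_maxGenEigenspace_eq_top, inf_top_eq] at key
  have hmN : m ∈ N := hm
  rw [key] at hmN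
  refine (iSup_le fun μ => ?_ : (⨆ μ, N ⊓ f.maxGenEigenspace μ) ≤ _) hmN
  by_cases hμ : q.IsRoot μ
  · exact inf_le_right.trans (maxGenEigenspace_le_genEigenSum f hμ)
  · rintro u ⟨hu, hu'⟩
    obtain ⟨k, hk⟩ := (End.mem_maxGenEigenspace f μ u).1 hu'
    have hc : IsCoprime ((Polynomial.X - Polynomial.C μ) ^ k) q :=
      IsCoprime.pow_left (((Polynomial.irreducible_X_sub_C μ).coprime_iff_not_dvd).2
        fun h => hμ (Polynomial.dvd_iff_isRoot.1 h))
    have := Submodule.disjoint_def.1 (Polynomial.disjoint_ker_aeval_of_isCoprime f hc) u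
      (by simpa [Algebra.algebraMap_eq_smul_one] using hk) hu
    rw [this]
    exact zero_mem _

end EigenSum

/-! ### Eigenvalue shifts under the Lie action, and the trace argument. -/

section LieEigen

variable {F G M : Type*} [Field F] [LieRing G] [LieAlgebra F G]
  [AddCommGroup M] [Module F M] [LieRingModule G M] [LieModule F G M]

variable (F) in
/-- The eigenvalues of `ad X`, together with `0`. -/
def adEigenvalues (X : G) : Set F := insert 0 {μ | (LieAlgebra.ad F G X).HasEigenvalue μ}

lemma adEigenvalues_finite [FiniteDimensional F G] (X : G) : (adEigenvalues F X).Finite :=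
  (End.finite_hasEigenvalue _).insert 0

lemma zero_mem_adEigenvalues (X : G) : (0 : F) ∈ adEigenvalues F X := Set.mem_insert _ _

variable [IsAlgClosed F] [FiniteDimensional F G]

/-- Split `y` along the generalized eigenspaces of `ad X`: a component for `r` maps the `t`-space of
`X` into the `(r + t)`-space. -/
lemma lie_mem_genEigenSum (X y : G) {m : M} {T : Set F}
    (hm : m ∈ genEigenSum (toEnd F G M X) T) :
    ⁅y, m⁆ ∈ genEigenSum (toEnd F G M X) (Set.image2 (· + ·) (adEigenvalues F X) T) := by
  set E := genEigenSum (toEnd F G M X) (Set.image2 (· + ·) (adEigenvalues F X) T) with hE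
  have hy : y ∈ ⨆ μ, (LieAlgebra.ad F G X).maxGenEigenspace μ := by
    rw [End.iSup_maxGenEigenspace_eq_top]; trivial
  suffices (⨆ μ, (LieAlgebra.ad F G X).maxGenEigenspace μ) ≤
      E.comap ((toEnd F G M : G →ₗ[F] End F M).flip m) from this hy
  refine iSup_le fun r => ?_
  by_cases hr : (LieAlgebra.ad F G X).HasEigenvalue r
  · intro y hy
    suffices genEigenSum (toEnd F G M X) T ≤ E.comap (toEnd F G M y) from this hm
    refine iSup₂_le fun t ht m hm => ?_
    exact maxGenEigenspace_le_genEigenSum _ (Set.mem_image2_of_mem (Set.mem_insert_of_mem _ hr) ht)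
      (LieModule.lie_mem_maxGenEigenspace_toEnd (R := F) hy hm)
  · have : (LieAlgebra.ad F G X).maxGenEigenspace r = ⊥ := by
      by_contra h
      exact hr (End.HasUnifEigenvalue.lt (k := ⊤) (m := 1) one_pos h)
    rw [this]; exact bot_le

lemma lieFiltration_le_genEigenSum (X : G) {T : Set F} {W : Submodule F M}
    (hW : W ≤ genEigenSum (toEnd F G M X) T) (n : ℕ) :
    lieFiltration F G W n ≤ genEigenSum (toEnd F G M X)
      {μ | ∃ r ∈ iteratedSumset (adEigenvalues F X) n, ∃ t ∈ T, μ = r + t} := by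
  induction n with
  | zero => exact hW.trans (genEigenSum_mono _ fun t ht => ⟨0, rfl, t, ht, (zero_add t).symm⟩)
  | succ n ih =>
    refine lieFiltration_succ_le (ih.trans (genEigenSum_mono _ ?_)) fun y m hm =>
      genEigenSum_mono _ ?_ (lie_mem_genEigenSum X y (ih hm))
    · rintro _ ⟨r, hr, t, ht, rfl⟩
      exact ⟨r, iteratedSumset_mono (zero_mem_adEigenvalues X) n.le_succ hr, t, ht, rfl⟩
    · rintro _ ⟨s, hs, _, ⟨r, hr, t, ht, rfl⟩, rfl⟩
      exact ⟨s + r, ⟨s, hs, r, hr, rfl⟩, t, ht, (add_assoc s r t).symm⟩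

omit [IsAlgClosed F] [FiniteDimensional F G] in
lemma trace_toEnd_eq_zero_of_mem_span {X : G}
    (hX : X ∈ Submodule.span F {z : G | ∃ a b : G, ⁅a, b⁆ = z}) :
    LinearMap.trace F M (toEnd F G M X) = 0 := by
  induction hX using Submodule.span_induction with
  | mem z hz =>
    obtain ⟨a, b, rfl⟩ := hz
    have : toEnd F G M ⁅a, b⁆ = toEnd F G M a * toEnd F G M b - toEnd F G M b * toEnd F G M a := by
      ext m
      simp
    rw [this, map_sub, LinearMap.trace_mul_comm, sub_self]
  | zero => simp
  | add a b _ _ ha hb => rw [map_add, map_add, ha, hb, add_zero]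
  | smul c a _ ha => rw [map_smul, map_smul, ha, smul_zero]

/-- An eigenvalue of a trace-free element on a module of dimension at most `B` lies in a finite
set that depends on `B` only. -/
lemma exists_nsmul_eigenvalue_add_eq_zero [FiniteDimensional F M] {X : G}
    (hX : X ∈ Submodule.span F {z : G | ∃ a b : G, ⁅a, b⁆ = z}) {B : ℕ} (hB : finrank F M ≤ B)
    {w : M} (hw : w ≠ 0) {l : F} (hl : ⁅X, w⁆ = l • w) :
    ∃ d, 0 < d ∧ d ≤ B ∧ ∃ s ∈ iteratedSumset (adEigenvalues F X) (B * B), d • l + s = 0 := by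
  -- `M` need not be irreducible, so the trace is taken on the submodule `P` generated by `w`, where
  -- all eigenvalues are shifts of `l`.
  obtain ⟨n, hn, hstab⟩ := exists_lieFiltration_succ_eq F G (Submodule.span F {w})
  let P : LieSubmodule F G M := { lieFiltration F G (Submodule.span F {w}) n with
    lie_mem := fun {y m} hm => lie_mem_of_lieFiltration_succ_eq hstab y hm }
  have hwP' : w ∈ lieFiltration F G (Submodule.span F {w}) n :=
    lieFiltration_mono F G (Submodule.span F {w}) (Nat.zero_le n)
      (Submodule.mem_span_singleton_self w)
  have hwP : w ∈ P := hwP'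
  have hW : Submodule.span F {w} ≤ genEigenSum (toEnd F G M X) {l} := by
    rw [Submodule.span_singleton_le_iff_mem]
    refine maxGenEigenspace_le_genEigenSum _ (Set.mem_singleton l) ?_
    rw [End.mem_maxGenEigenspace]
    exact ⟨1, by simp [hl]⟩
  have hPle := lieFiltration_le_genEigenSum X hW n
  have hroots : ∀ μ ∈ (toEnd F G P X).charpoly.roots,
      ∃ r ∈ iteratedSumset (adEigenvalues F X) n, μ = r + l := by
    intro μ hμ
    have hμ' : (toEnd F G P X).HasEigenvalue μ :=
      (End.hasEigenvalue_iff_isRoot_charpoly _ _).2 (Polynomial.isRoot_of_mem_roots hμ)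
    obtain ⟨v, hv⟩ := hμ'.exists_hasEigenvector
    have := mem_of_eigenvector_mem_genEigenSum (μ := μ) (hPle v.2)
      (fun h => hv.2 (Subtype.ext h)) (by
        have := congrArg (Subtype.val) hv.apply_eq_smul
        simpa using this)
    obtain ⟨r, hr, t, rfl, h⟩ := this
    exact ⟨r, hr, h⟩
  obtain ⟨t, ht, hsum⟩ := Multiset.sum_eq_nsmul_add_of_mem_iteratedSumset _ hroots
  have hsplit : (toEnd F G P X).charpoly.Splits := IsAlgClosed.splits _
  have hcard : (toEnd F G P X).charpoly.roots.card = finrank F P := by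
    rw [← hsplit.natDegree_eq_card_roots, LinearMap.charpoly_natDegree]
  rw [← End.trace_eq_sum_roots_charpoly_of_splits hsplit, trace_toEnd_eq_zero_of_mem_span hX,
    hcard] at hsum
  rw [hcard] at ht
  have hPB : finrank F P ≤ B := (Submodule.finrank_le (P : Submodule F M)).trans hB
  refine ⟨finrank F P, ?_, hPB, t,
    iteratedSumset_mono (zero_mem_adEigenvalues X) (Nat.mul_le_mul hPB (hn.trans hB)) ht, hsum.symm⟩
  exact (Module.finrank_pos_iff_exists_ne_zero (R := F) (M := P)).2
    ⟨⟨w, hwP⟩, fun h => hw (congrArg Subtype.val h)⟩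

end LieEigen

/-! ### Consequences of semisimplicity. -/

section Perfect

lemma LieAlgebra.IsSemisimple.mem_span_lie (K L : Type*) [Field K] [LieRing L] [LieAlgebra K L]
    [LieAlgebra.IsSemisimple K L] (x : L) :
    x ∈ Submodule.span K {z : L | ∃ a b : L, ⁅a, b⁆ = z} := by
  have h : (⁅(⊤ : LieIdeal K L), (⊤ : LieIdeal K L)⁆ : LieIdeal K L) = ⊤ := by
    rw [eq_top_iff, ← LieAlgebra.IsSemisimple.sSup_atoms_eq_top (R := K) (L := L)]
    refine sSup_le fun I hI => ?_
    rw [← lie_eq_self_of_isAtom_of_nonabelian I hI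
      (LieAlgebra.IsSemisimple.non_abelian_of_isAtom I hI)]
    exact LieSubmodule.mono_lie (le_sSup hI) (le_sSup hI)
  have hx : x ∈ (⁅(⊤ : LieIdeal K L), (⊤ : LieIdeal K L)⁆ : LieIdeal K L) := by
    rw [h]; trivial
  rw [← LieSubmodule.mem_toSubmodule, LieSubmodule.lieIdeal_oper_eq_linear_span'] at hx
  refine Submodule.span_mono ?_ hx
  rintro _ ⟨a, -, b, -, rfl⟩
  exact ⟨a, b, rfl⟩

/-- Otherwise Engel's theorem makes `L` nilpotent, so its radical is everything as well as zero. -/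
lemma LieAlgebra.IsSemisimple.exists_not_isNilpotent_ad (K L : Type*) [Field K] [LieRing L]
    [LieAlgebra K L] [LieAlgebra.IsSemisimple K L] [FiniteDimensional K L] [Nontrivial L] :
    ∃ x : L, ¬ IsNilpotent (LieAlgebra.ad K L x) := by
  by_contra! h
  have hn : LieRing.IsNilpotent L := (LieAlgebra.isNilpotent_iff_forall (R := K)).2 h
  have h1 : LieAlgebra.radical K L = ⊤ := LieAlgebra.radical_eq_top_of_isSolvable K L
  rw [LieAlgebra.HasTrivialRadical.radical_eq_bot] at h1
  have : Subsingleton L := (LieSubmodule.subsingleton_iff K L L).1 (subsingleton_of_bot_eq_top h1)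
  exact not_subsingleton L this

end Perfect

/-! ### Eigenvalues outside the base field. -/

section Eigenfunctional

variable {K L F M N : Type*} [Field K] [Field F] [Algebra K F]
  [AddCommGroup M] [Module K M] [AddCommGroup N] [Module K N]

/-- A nonzero functional with values in an extension field which is an eigenvector of the
transpose of `f`. -/
def HasEigenfunctional (f : End K M) (l : F) : Prop :=
  ∃ φ : M →ₗ[K] F, φ ≠ 0 ∧ ∀ m, φ (f m) = l * φ m

/-- If `0` were the only eigenvalue of the transpose `T` on `F`-valued functionals, `T` would be
nilpotent, and then `f` too because functionals separate points. -/
lemma exists_hasEigenfunctional_ne_zero [IsAlgClosed F] [FiniteDimensional K M] {f : End K M}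
    (hf : ¬ IsNilpotent f) : ∃ l : F, l ≠ 0 ∧ HasEigenfunctional f l := by
  by_contra! h
  let T : End F (M →ₗ[K] F) :=
    { toFun := fun φ => φ ∘ₗ f
      map_add' := fun _ _ => rfl
      map_smul' := fun _ _ => rfl }
  have hT (n : ℕ) (φ : M →ₗ[K] F) (m : M) : (T ^ n) φ m = φ ((f ^ n) m) := by
    induction n generalizing φ with
    | zero => rfl
    | succ n ih => rw [pow_succ, Module.End.mul_apply, ih, pow_succ']; rfl
  have h0 : ∀ l : F, l ≠ 0 → T.maxGenEigenspace l = ⊥ := by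
    intro l hl
    by_contra hne
    have : T.HasEigenvalue l := End.HasUnifEigenvalue.lt (k := ⊤) (m := 1) one_pos hne
    obtain ⟨φ, hφ⟩ := this.exists_hasEigenvector
    exact h l hl ⟨φ, hφ.2, fun m => LinearMap.congr_fun hφ.apply_eq_smul m⟩
  have htop : T.maxGenEigenspace 0 = ⊤ := by
    rw [eq_top_iff, ← T.iSup_maxGenEigenspace_eq_top]
    refine iSup_le fun l => ?_
    rcases eq_or_ne l 0 with rfl | hl
    · exact le_rfl
    · rw [h0 l hl]; exact bot_le
  rw [End.maxGenEigenspace_eq_genEigenspace_finrank] at htop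
  refine hf ⟨finrank F (M →ₗ[K] F), ?_⟩
  ext m
  refine (Module.forall_dual_apply_eq_zero_iff K _).1 fun ψ => ?_
  have hmem : (Algebra.linearMap K F ∘ₗ ψ) ∈
      T.genEigenspace 0 (finrank F (M →ₗ[K] F)) := by rw [htop]; trivial
  rw [End.mem_genEigenspace_nat, zero_smul, LinearMap.mem_ker] at hmem
  have := LinearMap.congr_fun hmem m
  rw [show T - 0 = T from sub_zero T] at this
  rw [hT] at this
  exact (algebraMap K F).injective (by simpa using this)

/-- The functional `φ` vanishes on the range of `q(f)`. An injective `q(f)` would be surjective,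
forcing `φ = 0`. -/
lemma HasEigenfunctional.exists_aeval_apply_eq_zero [FiniteDimensional K M] {f : End K M} {l : F}
    (h : HasEigenfunctional f l) {q : Polynomial K} (hq : Polynomial.aeval l q = 0) :
    ∃ v ≠ 0, Polynomial.aeval f q v = 0 := by
  obtain ⟨φ, h0, hφ⟩ := h
  have key (q : Polynomial K) (m : M) :
      φ (Polynomial.aeval f q m) = Polynomial.aeval l q * φ m := by
    induction q using Polynomial.induction_on' generalizing m with
    | add p q hp hq => simp [hp, hq, add_mul]
    | monomial n a =>
      have hpow (n : ℕ) (m : M) : φ ((f ^ n) m) = l ^ n * φ m := by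
        induction n generalizing m with
        | zero => simp
        | succ n ih => rw [pow_succ, Module.End.mul_apply, ih, hφ, pow_succ, mul_assoc]
      simp [Polynomial.aeval_monomial, hpow, Algebra.smul_def, mul_assoc]
  by_contra! hinj
  have hinj' : Function.Injective (Polynomial.aeval f q) := by
    rw [← LinearMap.ker_eq_bot, LinearMap.ker_eq_bot']
    intro m hm
    by_contra hne
    exact hinj m hne hm
  have hsurj := LinearMap.injective_iff_surjective.1 hinj'
  refine h0 (LinearMap.ext fun m => ?_)
  obtain ⟨m, rfl⟩ := hsurj m
  rw [key, hq, zero_mul, LinearMap.zero_apply]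

lemma HasEigenfunctional.exists_baseChange_eigenvector [FiniteDimensional K M] {f : End K M}
    {l : F} (h : HasEigenfunctional f l) :
    ∃ w : F ⊗[K] M, w ≠ 0 ∧ f.baseChange F w = l • w := by
  obtain ⟨φ, h0, hφ⟩ := h
  let Φ : F ⊗[K] M →ₗ[F] F := TensorProduct.AlgebraTensorModule.lift
    ((LinearMap.toSpanSingleton F (M →ₗ[K] F) φ))
  have hΦ (a : F) (m : M) : Φ (a ⊗ₜ m) = a * φ m := by simp [Φ]
  by_contra! hinj
  have hinj' : Function.Injective (f.baseChange F - l • 1 : End F (F ⊗[K] M)) := by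
    rw [← LinearMap.ker_eq_bot, LinearMap.ker_eq_bot']
    intro m hm
    by_contra hne
    exact hinj m hne (sub_eq_zero.1 (by simpa using hm))
  have hsurj := LinearMap.injective_iff_surjective.1 hinj'
  have hz : ∀ w, Φ ((f.baseChange F - l • 1 : End F (F ⊗[K] M)) w) = 0 := by
    intro w
    induction w with
    | zero => simp
    | add a b ha hb => rw [map_add, map_add, ha, hb, add_zero]
    | tmul a m => simp [hΦ, hφ, smul_tmul']; ring
  refine h0 (LinearMap.ext fun m => ?_)
  obtain ⟨w, hw⟩ := hsurj (1 ⊗ₜ m)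
  have := hz w
  rw [hw, hΦ, one_mul] at this
  exact this

end Eigenfunctional

/-! ### Irreducible modules with large eigenvalues. -/

section Modules

/-- Every natural multiple of an eigenvalue of `ad x` occurs as an eigenvalue of `x` on a
finite-dimensional module. -/
lemma exists_hasEigenfunctional_nsmul {K : Type u} {L : Type v} {F : Type*} [Field K] [Field F]
    [Algebra K F] [LieRing L] [LieAlgebra K L] [FiniteDimensional K L] {x : L} {a : F}
    (ha : HasEigenfunctional (LieAlgebra.ad K L x) a) (n : ℕ) :
    ∃ (V : Type (max u v)) (_ : AddCommGroup V) (_ : Module K V) (_ : LieRingModule L V)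
      (_ : LieModule K L V), FiniteDimensional K V ∧
        HasEigenfunctional (toEnd K L V x) (n * a) := by
  induction n with
  | zero =>
    let _ : LieRingModule L (ULift.{v} K) :=
      { bracket := fun _ _ => 0
        add_lie := fun _ _ _ => (add_zero 0).symm
        lie_add := fun _ _ _ => (add_zero 0).symm
        leibniz_lie := fun _ _ _ => (add_zero 0).symm }
    have hbr (y : L) (m : ULift.{v} K) : ⁅y, m⁆ = 0 := rfl
    let _ : LieModule K L (ULift.{v} K) :=
      { smul_lie := fun t y m => by simp [hbr]
        lie_smul := fun t y m => by simp [hbr] }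
    refine ⟨ULift.{v} K, inferInstance, inferInstance, inferInstance, inferInstance,
      inferInstance, Algebra.linearMap K F ∘ₗ ULift.moduleEquiv.toLinearMap, fun h => ?_,
      fun m => by simp [hbr]⟩
    simpa using LinearMap.congr_fun h ⟨1⟩
  | succ n ih =>
    obtain ⟨V, _, _, _, _, _, φ, hφ0, hφ⟩ := ih
    obtain ⟨ψ, hψ0, hψ⟩ := ha
    -- Tensoring with the adjoint module adds `a`: the product of two eigenfunctionals is one for
    -- the sum of their eigenvalues.
    let Φ : V ⊗[K] L →ₗ[K] F := LinearMap.mul' K F ∘ₗ TensorProduct.map φ ψ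
    have hΦ (m : V) (y : L) : Φ (m ⊗ₜ y) = φ m * ψ y := by simp [Φ]
    refine ⟨V ⊗[K] L, inferInstance, inferInstance, inferInstance, inferInstance, inferInstance,
      Φ, fun h => ?_, fun t => ?_⟩
    · obtain ⟨m, hm⟩ := DFunLike.ne_iff.1 hφ0
      obtain ⟨y, hy⟩ := DFunLike.ne_iff.1 hψ0
      refine mul_ne_zero hm hy ?_
      rw [← hΦ, h, LinearMap.zero_apply]
    · induction t with
      | zero => simp
      | add s t hs ht => rw [map_add, map_add, hs, ht, map_add, mul_add]
      | tmul m y =>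
        have h1 := hφ m
        have h2 := hψ y
        rw [toEnd_apply_apply] at h1
        rw [LieAlgebra.ad_apply] at h2
        rw [toEnd_apply_apply, TensorProduct.LieModule.lie_tmul_right, map_add, hΦ, hΦ, hΦ, h1, h2]
        push_cast
        ring

/-- Induction on dimension: given a proper nonzero submodule, the functional either descends to the
quotient or restricts to something nonzero. -/
lemma exists_isIrreducible_hasEigenfunctional {K : Type*} {L : Type*} {F : Type*} [Field K]
    [Field F] [Algebra K F] [LieRing L] [LieAlgebra K L] {x : L} {a : F} :
    ∀ (V : Type u) [AddCommGroup V] [Module K V] [LieRingModule L V] [LieModule K L V]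
      [FiniteDimensional K V], HasEigenfunctional (toEnd K L V x) a →
    ∃ (V : Type u) (_ : AddCommGroup V) (_ : Module K V) (_ : LieRingModule L V)
      (_ : LieModule K L V), FiniteDimensional K V ∧ IsIrreducible K L V ∧
        HasEigenfunctional (toEnd K L V x) a := by
  suffices H : ∀ (n : ℕ) (V : Type u) [AddCommGroup V] [Module K V] [LieRingModule L V]
      [LieModule K L V] [FiniteDimensional K V], finrank K V = n →
      HasEigenfunctional (toEnd K L V x) a →
      ∃ (V : Type u) (_ : AddCommGroup V) (_ : Module K V) (_ : LieRingModule L V)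
        (_ : LieModule K L V), FiniteDimensional K V ∧ IsIrreducible K L V ∧
          HasEigenfunctional (toEnd K L V x) a from
    fun V _ _ _ _ _ h => H _ V rfl h
  intro n
  induction n using Nat.strong_induction_on with
  | _ n ih =>
    intro V _ _ _ _ _ hn hV
    by_cases hirr : IsIrreducible K L V
    · exact ⟨V, inferInstance, inferInstance, inferInstance, inferInstance, inferInstance, hirr, hV⟩
    obtain ⟨φ, hφ0, hφ⟩ := hV
    have : Nontrivial V := by
      by_contra h
      rw [not_nontrivial_iff_subsingleton] at h
      exact hφ0 (LinearMap.ext fun m => by rw [Subsingleton.elim m 0, map_zero, map_zero])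
    obtain ⟨N, hNbot, hNtop⟩ : ∃ N : LieSubmodule K L V, N ≠ ⊥ ∧ N ≠ ⊤ := by
      by_contra! h
      exact hirr (LieModule.IsIrreducible.mk h)
    by_cases hN : ∀ m ∈ N, φ m = 0
    · let φ' : (V ⧸ N) →ₗ[K] F := (N : Submodule K V).liftQ φ fun m hm => hN m hm
      have hφ' (m : V) : φ' (LieSubmodule.Quotient.mk m) = φ m := rfl
      have hlt : finrank K (V ⧸ N) < n := by
        have h1 : finrank K (V ⧸ N) + finrank K N = finrank K V :=
          Submodule.finrank_quotient_add_finrank (N : Submodule K V)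
        have h2 : 0 < finrank K N := by
          have : Nontrivial N := (LieSubmodule.nontrivial_iff_ne_bot K L V).2 hNbot
          exact finrank_pos
        omega
      refine ih _ hlt (V ⧸ N) rfl ⟨φ', fun h => hφ0 ?_, fun m => ?_⟩
      · ext m
        rw [← hφ' m, h, LinearMap.zero_apply, LinearMap.zero_apply]
      · obtain ⟨m, rfl⟩ := LieSubmodule.Quotient.surjective_mk' N m
        exact hφ m
    · push Not at hN
      obtain ⟨m, hm, hm0⟩ := hN
      have hlt : finrank K N < n := by
        rw [← hn]
        exact Submodule.finrank_lt (s := (N : Submodule K V)) (by simpa using hNtop)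
      exact ih _ hlt N rfl ⟨φ ∘ₗ (N : Submodule K V).subtype,
        fun h => hm0 (LinearMap.congr_fun h ⟨m, hm⟩), fun m => hφ m⟩

end Modules

/-- A vector killed by `q(f)` lies in an `f`-invariant subspace of dimension at most `deg q` that
is killed by `q(f)`. -/
lemma Module.End.exists_invariant_of_aeval_apply_eq_zero {K M : Type*} [Field K] [AddCommGroup M]
    [Module K M] {f : End K M} {q : Polynomial K} (hq : q ≠ 0) {v : M}
    (hv : Polynomial.aeval f q v = 0) :
    ∃ W : Submodule K M, v ∈ W ∧ (∀ m ∈ W, f m ∈ W) ∧ (∀ m ∈ W, Polynomial.aeval f q m = 0) ∧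
      finrank K W ≤ q.natDegree := by
  let ev : Polynomial K →ₗ[K] M :=
    (LinearMap.toSpanSingleton (End K M) M v).restrictScalars K ∘ₗ
      (Polynomial.aeval f).toLinearMap
  have hev (p : Polynomial K) : ev p = Polynomial.aeval f p v := rfl
  have hmul (p r : Polynomial K) : ev (p * r) = Polynomial.aeval f p (ev r) := by
    rw [hev, hev, map_mul, Module.End.mul_apply]
  -- The subspace is the cyclic module `K[f] v`; reduction modulo `q` bounds its dimension.
  have hrange : LinearMap.range ev = (Polynomial.degreeLT K q.natDegree).map ev := by
    apply le_antisymm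
    · rintro _ ⟨p, rfl⟩
      refine ⟨p % q, ?_, ?_⟩
      · rw [SetLike.mem_coe, Polynomial.mem_degreeLT, ← Polynomial.degree_eq_natDegree hq]
        exact EuclideanDomain.mod_lt p hq
      · conv_rhs => rw [← EuclideanDomain.mod_add_div p q]
        rw [map_add, mul_comm, hmul, hev q, hv, map_zero, add_zero]
    · rintro _ ⟨p, -, rfl⟩
      exact ⟨p, rfl⟩
  refine ⟨LinearMap.range ev, ⟨1, by rw [hev]; simp⟩, ?_, ?_, ?_⟩
  · rintro _ ⟨p, rfl⟩
    exact ⟨Polynomial.X * p, by rw [hmul, Polynomial.aeval_X]⟩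
  · rintro _ ⟨p, rfl⟩
    rw [← hmul, mul_comm, hmul, hev q, hv, map_zero]
  · rw [hrange]
    have : Module.Finite K (Polynomial.degreeLT K q.natDegree) :=
      Module.Finite.equiv (Polynomial.degreeLTEquiv K q.natDegree).symm
    refine (Submodule.finrank_map_le ev _).trans ?_
    rw [(Polynomial.degreeLTEquiv K q.natDegree).finrank_eq, finrank_fin_fun]

/-! ### Passage to the algebraically closed field. -/

section BaseChange

variable {K F L M : Type*} [Field K] [Field F] [Algebra K F] [LieRing L] [LieAlgebra K L]
  [AddCommGroup M] [Module K M] [LieRingModule L M] [LieModule K L M]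

lemma aeval_baseChange_map_tmul (f : End K M) (q : Polynomial K) (m : M) :
    Polynomial.aeval (f.baseChange F) (q.map (algebraMap K F)) ((1 : F) ⊗ₜ[K] m) =
      1 ⊗ₜ Polynomial.aeval f q m := by
  rw [Polynomial.aeval_map_algebraMap]
  have : Polynomial.aeval (f.baseChange F) q =
      (Polynomial.aeval f q).baseChange F :=
    Polynomial.aeval_algHom_apply (Module.End.baseChangeHom K F M) f q
  rw [this, LinearMap.baseChange_tmul]

lemma tmul_mem_lieFiltration_baseChange {W : Submodule K M} {n : ℕ} {m : M}
    (hm : m ∈ lieFiltration K L W n) :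
    (1 : F) ⊗ₜ[K] m ∈ lieFiltration F (F ⊗[K] L) (W.baseChange F) n := by
  induction n generalizing m with
  | zero => exact Submodule.tmul_mem_baseChange_of_mem 1 hm
  | succ n ih =>
    suffices lieFiltration K L W (n + 1) ≤
        ((lieFiltration F (F ⊗[K] L) (W.baseChange F) (n + 1)).restrictScalars K).comap
          (TensorProduct.mk K F M 1) from this hm
    refine lieFiltration_succ_le (fun m hm => lieFiltration_mono _ _ _ n.le_succ (ih hm))
      fun y m hm => ?_
    have := lie_mem_lieFiltration_succ ((1 : F) ⊗ₜ[K] y) (ih hm)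
    rwa [LieAlgebra.ExtendScalars.bracket_tmul, one_mul] at this

/-- If no sum of at most `n` eigenvalues of `ad x` and a root of `q` vanishes, then `x` acts
injectively on the `n`-th term of the filtration generated by a subspace killed by `q(x)`. -/
lemma eq_zero_of_lie_eq_zero_of_mem_lieFiltration [IsAlgClosed F] [FiniteDimensional K L]
    [FiniteDimensional K M] {x : L} {q : Polynomial K} {W : Submodule K M}
    (hW : ∀ m ∈ W, Polynomial.aeval (toEnd K L M x) q m = 0) {n : ℕ}
    (hq : ∀ t : F, Polynomial.aeval t q = 0 →
      ∀ r ∈ iteratedSumset (adEigenvalues F ((1 : F) ⊗ₜ[K] x)) n, r + t ≠ 0)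
    {m : M} (hm : m ∈ lieFiltration K L W n) (h0 : ⁅x, m⁆ = 0) : m = 0 := by
  by_contra hne
  have hWF : W.baseChange F ≤
      genEigenSum (toEnd F (F ⊗[K] L) (F ⊗[K] M) (1 ⊗ₜ x))
        {μ | (q.map (algebraMap K F)).IsRoot μ} := by
    rw [Submodule.baseChange_eq_span, Submodule.span_le]
    rintro _ ⟨w, hw, rfl⟩
    apply mem_genEigenSum_of_aeval_eq_zero
    rw [LieModule.toEnd_baseChange, TensorProduct.mk_apply, aeval_baseChange_map_tmul, hW w hw,
      tmul_zero]
  have hmem := lieFiltration_le_genEigenSum _ hWF n (tmul_mem_lieFiltration_baseChange hm)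
  have hne' : (1 : F) ⊗ₜ[K] m ≠ 0 := fun h => hne <| by
    have := (Module.FaithfullyFlat.tensorProduct_mk_injective (A := K) (B := F) M)
    exact this (by simpa using h)
  obtain ⟨r, hr, t, ht, h⟩ := mem_of_eigenvector_mem_genEigenSum (μ := 0) hmem hne'
    (by simp [h0])
  refine hq t ?_ r hr h.symm
  rwa [Set.mem_ofPred_eq, Polynomial.IsRoot.def, Polynomial.eval_map_algebraMap] at ht

end BaseChange

/-- Each pair `(s, z)` excludes only the value `-s / z`, and characteristic zero supplies infinitely
many candidates. -/
lemma exists_nat_forall_add_mul_ne_zero {F : Type*} [Field F] [CharZero F] {S Z : Set F}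
    (hS : S.Finite) (hZ : Z.Finite) (hZ0 : (0 : F) ∉ Z) :
    ∃ m : ℕ, m ≠ 0 ∧ ∀ s ∈ S, ∀ z ∈ Z, s + m * z ≠ 0 := by
  have hfin : (insert 0 (Set.image2 (fun s z => -s / z) S Z)).Finite := (hS.image2 _ hZ).insert 0
  obtain ⟨_, ⟨m, rfl⟩, hm⟩ :=
    (Set.infinite_range_of_injective (Nat.cast_injective (R := F))).exists_notMem_finite hfin
  refine ⟨m, fun h => hm (Set.mem_insert_iff.2 (Or.inl (by simp [h]))), fun s hs z hz h => hm ?_⟩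
  have hz0 : z ≠ 0 := fun h => hZ0 (h ▸ hz)
  refine Set.mem_insert_of_mem _ ⟨s, hs, z, hz, ?_⟩
  rw [div_eq_iff hz0]
  linear_combination -h

theorem proposition4 {K : Type u} {L : Type v} [Field K] [CharZero K] [LieRing L] [LieAlgebra K L]
    [FiniteDimensional K L] [Nontrivial L] [LieAlgebra.IsSemisimple K L] (k : ℕ) (hk : 0 < k) :
    ∃ (V : Type (max u v)) (_ : AddCommGroup V) (_ : Module K V) (_ : LieRingModule L V)
      (_ : LieModule K L V),
      FiniteDimensional K V ∧ LieModule.IsIrreducible K L V ∧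
        ∃ n : ℕ, IsJetOrder K L V n ∧ k < n := by
  let F := AlgebraicClosure K
  have : CharZero F := charZero_of_injective_algebraMap (algebraMap K F).injective
  obtain ⟨x, hx⟩ := LieAlgebra.IsSemisimple.exists_not_isNilpotent_ad K L
  obtain ⟨a, ha0, ha⟩ := exists_hasEigenfunctional_ne_zero (F := F) hx
  let X : F ⊗[K] L := 1 ⊗ₜ x
  let p := minpoly K a
  have hint : IsIntegral K a := (AlgebraicClosure.isAlgebraic K).isIntegral.isIntegral a
  have hp0 : p ≠ 0 := minpoly.ne_zero hint
  let B := (1 + finrank K L) ^ k * p.natDegree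
  have hSfin (n : ℕ) : (iteratedSumset (adEigenvalues F X) n).Finite :=
    iteratedSumset_finite (adEigenvalues_finite X) n
  -- Two requirements at once: sums of `k` terms against roots of `p` for injectivity of `x`, and
  -- sums of `B * B` terms against `d * a` for `dim V > B`.
  obtain ⟨m, hm0, hm⟩ := exists_nat_forall_add_mul_ne_zero (F := F)
    ((hSfin k).union (hSfin (B * B)))
    ((p.rootSet_finite F).union ((Set.finite_Icc 1 B).image fun d : ℕ => (d : F) * a)) (by
      rintro (h | ⟨d, hd, h⟩)
      · have h' := (Polynomial.mem_rootSet.1 h).2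
        rw [← Polynomial.coeff_zero_eq_aeval_zero'] at h'
        exact minpoly.coeff_zero_ne_zero hint ha0
          ((map_eq_zero_iff _ (algebraMap K F).injective).1 h')
      · rcases mul_eq_zero.1 h with h | h
        · have := hd.1
          rw [Nat.cast_eq_zero] at h
          omega
        · exact ha0 h)
  have hmF : (m : F) ≠ 0 := Nat.cast_ne_zero.2 hm0
  have hmK : (m : K) ≠ 0 := Nat.cast_ne_zero.2 hm0
  obtain ⟨V₀, _, _, _, _, _, hV₀⟩ := exists_hasEigenfunctional_nsmul ha m
  obtain ⟨V, _, _, _, _, _, _, hV⟩ := exists_isIrreducible_hasEigenfunctional V₀ hV₀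
  refine ⟨V, inferInstance, inferInstance, inferInstance, inferInstance, inferInstance,
    inferInstance, ?_⟩
  have hdim : B < finrank K V := by
    by_contra! hle
    obtain ⟨w, hw0, hw⟩ := hV.exists_baseChange_eigenvector
    rw [← LieModule.toEnd_baseChange] at hw
    have hX : X ∈ Submodule.span F {z : F ⊗[K] L | ∃ a b : F ⊗[K] L, ⁅a, b⁆ = z} := by
      suffices Submodule.span K {z : L | ∃ a b : L, ⁅a, b⁆ = z} ≤
          ((Submodule.span F {z : F ⊗[K] L | ∃ a b, ⁅a, b⁆ = z}).restrictScalars K).comap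
            (TensorProduct.mk K F L 1) from this (LieAlgebra.IsSemisimple.mem_span_lie K L x)
      refine Submodule.span_le.2 ?_
      rintro _ ⟨b, c, rfl⟩
      exact Submodule.subset_span ⟨1 ⊗ₜ b, 1 ⊗ₜ c, by simp⟩
    obtain ⟨d, hd0, hdB, s, hs, h⟩ := exists_nsmul_eigenvalue_add_eq_zero hX
      ((finrank_baseChange (R := F) (M' := V)).trans_le hle) hw0 hw
    refine hm s (Or.inr hs) (d * a) (Or.inr ⟨d, ⟨hd0, hdB⟩, rfl⟩) ?_
    rw [nsmul_eq_mul] at h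
    linear_combination h
  -- `q(X) = p(X / m)` vanishes at `m * a` and has the degree of `p`, which keeps `B` independent of
  -- `m`.
  let q := p.comp (Polynomial.C (m : K)⁻¹ * Polynomial.X)
  have hqdeg : q.natDegree = p.natDegree := by
    rw [Polynomial.natDegree_comp, Polynomial.natDegree_C_mul_X _ (inv_ne_zero hmK), mul_one]
  have hqev (t : F) : Polynomial.aeval t q = Polynomial.aeval ((m : F)⁻¹ * t) p := by
    simp [q, Polynomial.aeval_comp]
  have hq0 : q ≠ 0 := fun h => by
    have h1 := minpoly.natDegree_pos hint
    have h2 : p.natDegree = 0 := by rw [← hqdeg, h, Polynomial.natDegree_zero]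
    exact h1.ne' h2
  obtain ⟨v, hv0, hv⟩ := hV.exists_aeval_apply_eq_zero (q := q) (by
    rw [hqev, inv_mul_cancel_left₀ hmF]; exact minpoly.aeval K a)
  obtain ⟨W, hvW, hWx, hWq, hWdim⟩ :=
    Module.End.exists_invariant_of_aeval_apply_eq_zero hq0 hv
  have hinj (i : ℕ) (hi : i ≤ k) (w : V) (hw : w ∈ lieFiltration K L W i) (h0 : ⁅x, w⁆ = 0) :
      w = 0 := by
    refine eq_zero_of_lie_eq_zero_of_mem_lieFiltration (F := F) hWq (fun t ht r hr h => ?_) hw h0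
    refine hm r (Or.inl (iteratedSumset_mono (zero_mem_adEigenvalues X) hi hr)) ((m : F)⁻¹ * t)
      (Or.inl ?_) (by rwa [mul_inv_cancel_left₀ hmF])
    rw [Polynomial.mem_rootSet]
    exact ⟨hp0, by rw [← hqev, ht]⟩
  obtain ⟨G, hG⟩ := isJetFiltration_of_lieFiltration (K := K) (L := L) (M := V) (W := W) (n := k)
    (fun h => hv0 (by simpa [h] using hvW))
    (fun h => by
      have := finrank_lieFiltration_le K L W k
      rw [h, finrank_top] at this
      have h2 : (1 + finrank K L) ^ k * finrank K W ≤ B := by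
        rw [hqdeg] at hWdim
        exact Nat.mul_le_mul_left _ hWdim
      omega)
    (fun i hi => by
      have hinv := lie_mem_lieFiltration_of_invariant (x := x) hWx i
      have hinj' : Function.Injective ((toEnd K L V x).restrict hinv) := by
        rw [← LinearMap.ker_eq_bot, LinearMap.ker_eq_bot']
        intro w hw
        exact Subtype.ext (hinj i hi w w.2 (congrArg Subtype.val hw))
      intro w hw
      obtain ⟨u, hu⟩ := LinearMap.injective_iff_surjective.1 hinj' ⟨w, hw⟩
      exact ⟨x, u, u.2, congrArg Subtype.val hu⟩)
  obtain ⟨n, hn, hkn⟩ := hG.exists_isJetOrder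
  exact ⟨n, hn, hkn⟩
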